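/- Let $d\ge 3$ be an integer and let $PSL(d,\mathbb Z)$ be the quotient of $SL(d,\mathbb Z)$ by its center. For $\gamma=[g]\in PSL(d,\mathbb Z)$ with $g\in SL(d,\mathbb Z)$, put $\|\gamma\|=\|g\|=\sup\{\|gx\| : x\in\mathbb R^d,\ \|x\|=1\}$, where $\|x\|$ is the Euclidean norm; this does not depend on the choice of $g$, because the center of $SL(d,\mathbb Z)$ is contained in $\{I,-I\}$. For a finite generating set $\Sigma$ of $PSL(d,\mathbb Z)$, let $d_\Sigma(\gamma_1,\gamma_2)$ be the word distance, i.e. the least $n$ such that $\gamma_1^{-1}\gamma_2$ is a product of $n$ elements of $\Sigma\cup\Sigma^{-1}$. Then $PSL(d,\mathbb Z)$ is finitely generated, and for every finite generating set $\Sigma$ there is a constant $K>0$ such that $$d_\Sigma(1,\gamma)\le K\log\|\gamma\|$$ for every $\gamma\in PSL(d,\mathbb Z)$, except for those $\gamma\neq 1$ with $\|\gamma\|=1$ (the finitely many nontrivial classes of signed permutation matrices). -/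

import Mathlib

open scoped MatrixGroups

/-- The word distance on a group `G` induced by a set `S`: the least `n` such that `g₁⁻¹ * g₂` is a
product of `n` factors, each of which lies in `S` or is the inverse of an element of `S`. If `S`
generates `G`, then such an `n` exists for all `g₁` and `g₂`. -/
noncomputable def wordDist {G : Type*} [Group G] (S : Set G) (g₁ g₂ : G) : ℕ :=
  sInf {n : ℕ | ∃ w : List G,
    w.length = n ∧ (∀ x ∈ w, x ∈ S ∨ x⁻¹ ∈ S) ∧ w.prod = g₁⁻¹ * g₂}

/-- The operator norm `sup {‖g x‖ : ‖x‖ = 1}` of an integer matrix of determinant one acting on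
Euclidean space `ℝ^d`. -/
noncomputable def slNorm {d : ℕ} (g : SL(d, ℤ)) : ℝ :=
  ‖Matrix.toEuclideanCLM (n := Fin d) (𝕜 := ℝ) ((g : Matrix (Fin d) (Fin d) ℤ).map Int.cast)‖

/-- The operator norm does not change under multiplication by a central element,
which is `I` or `-I`. -/
theorem slNorm_mul_center {d : ℕ} (g z : SL(d, ℤ)) (hz : z ∈ Subgroup.center SL(d, ℤ)) :
    slNorm (g * z) = slNorm g := by
  obtain ⟨r, hr, hz⟩ := Matrix.SpecialLinearGroup.mem_center_iff.mp hz
  rcases Nat.eq_zero_or_pos d with rfl | hd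
  · rw [Subsingleton.elim (g * z) g]
  · have hu : IsUnit r := IsUnit.of_pow_eq_one hr (by simpa using hd.ne')
    rcases Int.isUnit_iff.mp hu with rfl | rfl
    · have h : z = 1 := Subtype.ext (by rw [← hz]; simp)
      rw [h, mul_one]
    · have h : ((g * z : SL(d, ℤ)) : Matrix (Fin d) (Fin d) ℤ).map (Int.cast : ℤ → ℝ)
          = -((g : Matrix (Fin d) (Fin d) ℤ).map (Int.cast : ℤ → ℝ)) := by
        rw [Matrix.SpecialLinearGroup.coe_mul, ← hz]
        ext i j
        simp
      rw [slNorm, slNorm, h, map_neg, norm_neg]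

/-- The norm of an element `[g]` of `PSL(d, ℤ)` is the operator norm of any of its
representatives `g`. -/
noncomputable def pslNorm {d : ℕ} : PSL(d, ℤ) → ℝ :=
  Quotient.lift (slNorm (d := d)) (fun a b hab => by
    have h : a⁻¹ * b ∈ Subgroup.center SL(d, ℤ) := QuotientGroup.leftRel_apply.mp hab
    have := slNorm_mul_center a (a⁻¹ * b) h
    rw [mul_inv_cancel_left] at this
    exact this.symm)

theorem pslNorm_mk {d : ℕ} (g : SL(d, ℤ)) : pslNorm (QuotientGroup.mk g : PSL(d, ℤ)) = slNorm g :=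
  rfl

/-! Row reduction over `ℤ` writes `g` as a product of elementary matrices, but a naive count of unit
steps is polynomial in `‖g‖`. Two savings make it logarithmic.

Since `d ≥ 3`, the transvection with entry `n` is a word of length `O(1 + log |n|)`: the
transvections in positions `(i, j)` and `(k, j)` form a copy of `ℤ²` on which a hyperbolic matrix
acts by conjugation, and a Horner scheme reaches exponentially large vectors in linearly many steps
(`shortBy_transvection`). The Euclidean algorithm with balanced remainders then costs the sum of the
logarithms of its quotients plus a constant per step, and this telescopes to the logarithm of the
input (`exists_shortBy_euclid`).

Clearing a matrix takes a number of such moves that depends only on `d`. A word of length `r`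
changes `log ‖g‖` by `O(r)`, so the cost of each move stays linear in the initial `1 + log ‖g‖`
(`Reduces.trans`). Passing to the quotient and to another finite generating set costs a constant
factor; the additive constant is absorbed because only finitely many matrices have norm at most `2`.
-/

open scoped Pointwise in
/-- `ShortBy E r g` says that `g` is a product of at most `r` elements of `E`. -/
def ShortBy {G : Type*} [Group G] (E : Set G) (r : ℝ) (g : G) : Prop :=
  ∃ n : ℕ, (n : ℝ) ≤ r ∧ g ∈ E ^ n

namespace ShortBy

open scoped Pointwise

variable {G : Type*} [Group G] {E : Set G} {r s : ℝ} {g h : G}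

theorem mono (hg : ShortBy E r g) (hrs : r ≤ s) : ShortBy E s g := by
  obtain ⟨n, hn, hgn⟩ := hg
  exact ⟨n, hn.trans hrs, hgn⟩

theorem one (hr : 0 ≤ r) : ShortBy E r (1 : G) := ⟨0, by simpa using hr, by simp⟩

theorem of_mem (hg : g ∈ E) : ShortBy E 1 g := ⟨1, by simp, by simpa using hg⟩

theorem mul (hg : ShortBy E r g) (hh : ShortBy E s h) : ShortBy E (r + s) (g * h) := by
  obtain ⟨m, hm, hgm⟩ := hg
  obtain ⟨n, hn, hhn⟩ := hh
  exact ⟨m + n, by push_cast; linarith, by rw [pow_add]; exact Set.mul_mem_mul hgm hhn⟩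

theorem inv (hE : E⁻¹ = E) (hg : ShortBy E r g) : ShortBy E r g⁻¹ := by
  obtain ⟨n, hn, hgn⟩ := hg
  refine ⟨n, hn, ?_⟩
  rw [← hE, inv_pow]
  simpa using hgn

theorem mem_closure (hg : ShortBy E r g) : g ∈ Subgroup.closure E := by
  obtain ⟨n, -, hgn⟩ := hg
  have key : ∀ n : ℕ, E ^ n ⊆ Subgroup.closure E := by
    intro n
    induction n with
    | zero => simp
    | succ n ih =>
      rw [pow_succ]
      rintro _ ⟨u, hu, v, hv, rfl⟩
      exact mul_mem (ih hu) (Subgroup.subset_closure hv)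
  exact key n hgn

theorem pow (hg : ShortBy E r g) (n : ℕ) : ShortBy E (n * r) (g ^ n) := by
  induction n with
  | zero => simpa using one (E := E) (G := G) (le_refl (0 : ℝ))
  | succ n ih =>
    rw [pow_succ]
    exact (ih.mul hg).mono (by push_cast; linarith)

end ShortBy

/-! ### Exponential distortion in an abstract group. -/

section ExponentialDistortion

/-- The first column `(p, q)` of the `k`-th power of the matrix `!![2, 1; 1, 1]`. -/
def catCol : ℕ → ℤ × ℤ
  | 0 => (1, 0)
  | k + 1 => (2 * (catCol k).1 + (catCol k).2, (catCol k).1 + (catCol k).2)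

/-- The slope bound `4q ≤ 3p` is what limits the growth factor of the traces to `3`, hence the
digits to `2`. -/
theorem catCol_bounds (k : ℕ) :
    0 ≤ (catCol k).2 ∧ 4 * (catCol k).2 ≤ 3 * (catCol k).1 ∧ 2 ^ k ≤ (catCol k).1 := by
  induction k with
  | zero => simp [catCol]
  | succ k ih =>
    have : (0 : ℤ) < 2 ^ k := by positivity
    simp only [catCol, pow_succ]
    omega

/-- The trace of the `k`-th power of the matrix `!![2, 1; 1, 1]`. -/
def catTrace (k : ℕ) : ℤ := 2 * (catCol k).1 - (catCol k).2

theorem catTrace_succ_le (k : ℕ) : catTrace (k + 1) ≤ 3 * catTrace k := by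
  have := catCol_bounds k
  simp only [catTrace, catCol]
  omega

theorem two_pow_le_catTrace (k : ℕ) : 2 ^ k ≤ catTrace k := by
  have := catCol_bounds k
  simp only [catTrace]
  omega

/-- Greedy expansion with the traces as place values: consecutive ones have ratio at most `3`, so
each quotient is below `3`. The last remainder is below `catTrace 0 = 2`. -/
theorem exists_catTrace_digits (k : ℕ) (n : ℤ) (h0 : 0 ≤ n) (hn : n < catTrace k) :
    ∃ (r : ℕ) (c : ℕ → ℕ), r ≤ 1 ∧ (∀ i, c i ≤ 2) ∧
      n = r + ∑ i ∈ Finset.range k, (c i : ℤ) * catTrace i := by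
  induction k generalizing n with
  | zero =>
    simp only [catTrace, catCol] at hn
    exact ⟨n.toNat, 0, by omega, by simp, by simp; omega⟩
  | succ k ih =>
    have hle := catTrace_succ_le k
    have hpos : 0 < catTrace k := lt_of_lt_of_le (by positivity) (two_pow_le_catTrace k)
    have hq : n / catTrace k < 3 := Int.ediv_lt_of_lt_mul hpos (by linarith)
    have hq0 : 0 ≤ n / catTrace k := Int.ediv_nonneg h0 hpos.le
    obtain ⟨r, c, hr, hc, hrc⟩ := ih (n % catTrace k) (Int.emod_nonneg _ hpos.ne')
      (Int.emod_lt_of_pos _ hpos)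
    refine ⟨r, fun i => if i < k then c i else (n / catTrace k).toNat, hr, ?_, ?_⟩
    · intro i
      dsimp only
      split_ifs
      · exact hc i
      · omega
    · dsimp only
      rw [Finset.sum_range_succ, if_neg (lt_irrefl k), Int.toNat_of_nonneg hq0]
      have : ∑ i ∈ Finset.range k, ((if i < k then c i else (n / catTrace k).toNat : ℕ) : ℤ)
          * catTrace i = ∑ i ∈ Finset.range k, (c i : ℤ) * catTrace i :=
        Finset.sum_congr rfl fun i hi => by rw [if_pos (Finset.mem_range.mp hi)]
      rw [this, ← add_assoc, ← hrc]
      linarith [Int.emod_add_mul_ediv n (catTrace k), mul_comm (catTrace k) (n / catTrace k)]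

variable {G : Type*} [Group G] {E : Set G} {x y a : G}

theorem conj_zpow_mul_zpow (hxy : Commute x y) (hx : a * x * a⁻¹ = x ^ 2 * y)
    (hy : a * y * a⁻¹ = x * y) (m n : ℤ) :
    a * (x ^ m * y ^ n) * a⁻¹ = x ^ (2 * m + n) * y ^ (m + n) := by
  have h : a * (x ^ m * y ^ n) * a⁻¹ = (a * x * a⁻¹) ^ m * (a * y * a⁻¹) ^ n := by
    rw [conj_zpow, conj_zpow]; group
  rw [h, hx, hy, (hxy.pow_left 2).mul_zpow, hxy.mul_zpow, ← zpow_natCast x 2, ← zpow_mul,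
    mul_assoc, ← mul_assoc (y ^ m), ((hxy.zpow_zpow n m).eq).symm, zpow_add, zpow_add]
  push_cast
  group

theorem zpow_mul_zpow_add (hxy : Commute x y) (m n m' n' : ℤ) :
    x ^ (m + m') * y ^ (n + n') = (x ^ m * y ^ n) * (x ^ m' * y ^ n') := by
  rw [zpow_add, zpow_add, mul_assoc, mul_assoc, ← mul_assoc (y ^ n), ← mul_assoc (x ^ m') (y ^ n),
    (hxy.zpow_zpow m' n).eq]

/-- A Horner scheme for a linear recurrence that is implemented by conjugation with `b`. -/
theorem shortBy_sum_of_conj (hE : E⁻¹ = E) (hxy : Commute x y) (hxE : x ∈ E) {b : G} {β : ℝ}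
    (hb : ShortBy E β b)
    {A : ℤ × ℤ →+ ℤ × ℤ}
    (hconj : ∀ v : ℤ × ℤ, b * (x ^ v.1 * y ^ v.2) * b⁻¹ = x ^ (A v).1 * y ^ (A v).2)
    {u : ℕ → ℤ × ℤ} (hu0 : u 0 = (1, 0)) (hu : ∀ i, u (i + 1) = A (u i))
    (k : ℕ) (c : ℕ → ℕ) (hc : ∀ i, c i ≤ 2) :
    ShortBy E (k * (2 + 2 * β)) (x ^ (∑ i ∈ Finset.range k, c i • u i).1 *
      y ^ (∑ i ∈ Finset.range k, c i • u i).2) := by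
  induction k generalizing c with
  | zero => simpa using ShortBy.one (E := E) (le_refl (0 : ℝ))
  | succ k ih =>
    have hsum : ∑ i ∈ Finset.range (k + 1), c i • u i
        = ((c 0 : ℤ), 0) + A (∑ i ∈ Finset.range k, c (i + 1) • u i) := by
      rw [Finset.sum_range_succ', map_sum, add_comm]
      simp only [map_nsmul, hu, hu0]
      simp
    rw [hsum, Prod.fst_add, Prod.snd_add, zpow_mul_zpow_add hxy, ← hconj]
    have h1 : ShortBy E 2 (x ^ (c 0 : ℤ) * y ^ (0 : ℤ)) := by
      have h := (ShortBy.of_mem hxE).pow (c 0)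
      have h2 : (c 0 : ℝ) ≤ 2 := by exact_mod_cast hc 0
      simpa using h.mono (by linarith)
    exact (h1.mul ((hb.mul (ih (fun i => c (i + 1)) fun i => hc _)).mul (hb.inv hE))).mono
      (by push_cast; linarith)

/-- By Cayley–Hamilton in determinant one, `A^i + A^(-i) = tr(A^i)`. Horner schemes for `a` and
`a⁻¹` with the same digits therefore cancel in the `y` direction and add up to the trace expansion
of `n` in the `x` direction. -/
theorem shortBy_zpow_of_lt_two_pow (hE : E⁻¹ = E) (hxE : x ∈ E) {α : ℝ} (ha : ShortBy E α a)
    (hxy : Commute x y) (hx : a * x * a⁻¹ = x ^ 2 * y) (hy : a * y * a⁻¹ = x * y)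
    (k : ℕ) (n : ℤ) (hn : |n| < 2 ^ k) : ShortBy E (1 + k * (4 + 4 * α)) (x ^ n) := by
  wlog h0 : 0 ≤ n generalizing n
  · have := (this (-n) (by rwa [abs_neg]) (by omega)).inv hE
    simpa using this
  rw [abs_of_nonneg h0] at hn
  obtain ⟨r, c, hr, hc, rfl⟩ := exists_catTrace_digits k n h0
    (hn.trans_le (two_pow_le_catTrace k))
  let A : ℤ × ℤ →+ ℤ × ℤ := AddMonoidHom.mk' (fun v => (2 * v.1 + v.2, v.1 + v.2)) (by
    intro v w; ext <;> simp <;> ring)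
  let B : ℤ × ℤ →+ ℤ × ℤ := AddMonoidHom.mk' (fun v => (v.1 - v.2, -v.1 + 2 * v.2)) (by
    intro v w; ext <;> simp <;> ring)
  have hA : ∀ v : ℤ × ℤ, a * (x ^ v.1 * y ^ v.2) * a⁻¹ = x ^ (A v).1 * y ^ (A v).2 :=
    fun v => conj_zpow_mul_zpow hxy hx hy v.1 v.2
  have hB : ∀ v : ℤ × ℤ, a⁻¹ * (x ^ v.1 * y ^ v.2) * a⁻¹⁻¹ = x ^ (B v).1 * y ^ (B v).2 := by
    intro v
    have hv : v = A (B v) := by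
      ext <;> simp [A, B] <;> ring
    conv_lhs => rw [hv]
    rw [← hA]
    group
  have hU := shortBy_sum_of_conj hE hxy hxE ha hA (u := catCol) rfl (fun i => rfl) k c hc
  -- The sequence is the first column of `A^(-i)`, where `A^i` has rows `(p, q)` and `(q, p - q)`.
  have hW := shortBy_sum_of_conj hE hxy hxE (ha.inv hE) hB
    (u := fun i => ((catCol i).1 - (catCol i).2, -(catCol i).2)) rfl
    (fun i => by ext <;> simp [B, catCol] <;> ring) k c hc
  have hr' : ShortBy E 1 (x ^ (r : ℤ) * y ^ (0 : ℤ)) := by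
    have h2 : (r : ℝ) ≤ 1 := by exact_mod_cast hr
    simpa using ((ShortBy.of_mem hxE).pow r).mono (by linarith)
  have h := hr'.mul (hU.mul hW)
  rw [← zpow_mul_zpow_add hxy, ← zpow_mul_zpow_add hxy] at h
  have e1 : (r : ℤ) + ((∑ i ∈ Finset.range k, c i • catCol i).1 + (∑ i ∈ Finset.range k,
      c i • (((catCol i).1 - (catCol i).2, -(catCol i).2) : ℤ × ℤ)).1)
      = r + ∑ i ∈ Finset.range k, (c i : ℤ) * catTrace i := by
    rw [Prod.fst_sum, Prod.fst_sum, ← Finset.sum_add_distrib]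
    congr 1
    refine Finset.sum_congr rfl fun i _ => ?_
    simp [catTrace]; ring
  have e2 : (0 : ℤ) + ((∑ i ∈ Finset.range k, c i • catCol i).2 + (∑ i ∈ Finset.range k,
      c i • (((catCol i).1 - (catCol i).2, -(catCol i).2) : ℤ × ℤ)).2) = 0 := by
    rw [Prod.snd_sum, Prod.snd_sum, ← Finset.sum_add_distrib, zero_add]
    exact Finset.sum_eq_zero fun i _ => by simp
  rw [e1, e2, zpow_zero, mul_one] at h
  exact h.mono (by linarith)

end ExponentialDistortion

/-! ### Elementary matrices and their distortion. -/

section SpecialLinear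

open Matrix Matrix.SpecialLinearGroup

variable {d : ℕ}

/-- The elementary matrices with off-diagonal entry `1` or `-1`, together with the identity. -/
def elementarySet (d : ℕ) : Set SL(d, ℤ) :=
  {g | g = 1 ∨ ∃ (i j : Fin d) (h : i ≠ j), g = transvection h 1 ∨ g = transvection h (-1)}

theorem elementarySet_inv : (elementarySet d)⁻¹ = elementarySet d := by
  have key : ∀ g ∈ elementarySet d, g⁻¹ ∈ elementarySet d := by
    rintro g (rfl | ⟨i, j, h, rfl | rfl⟩)
    · exact Or.inl inv_one
    · exact Or.inr ⟨i, j, h, Or.inr (transvection_inv h 1)⟩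
    · exact Or.inr ⟨i, j, h, Or.inl (by rw [transvection_inv, neg_neg])⟩
  ext g
  exact ⟨fun h => by simpa using key _ h, fun h => key _ h⟩

theorem elementarySet_finite : (elementarySet d).Finite := by
  have h : elementarySet d ⊆ {1} ∪
      ((Set.range fun p : {p : Fin d × Fin d // p.1 ≠ p.2} => transvection p.2 (1 : ℤ)) ∪
        Set.range fun p : {p : Fin d × Fin d // p.1 ≠ p.2} => transvection p.2 (-1 : ℤ)) := by
    rintro g (rfl | ⟨i, j, h, rfl | rfl⟩)
    · exact Or.inl rfl
    · exact Or.inr (Or.inl ⟨⟨(i, j), h⟩, rfl⟩)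
    · exact Or.inr (Or.inr ⟨⟨(i, j), h⟩, rfl⟩)
  exact ((Set.finite_singleton _).union ((Set.finite_range _).union (Set.finite_range _))).subset h

theorem transvection_one_mem_elementarySet {i j : Fin d} (h : i ≠ j) :
    transvection h (1 : ℤ) ∈ elementarySet d := Or.inr ⟨i, j, h, Or.inl rfl⟩

theorem transvection_neg_one_mem_elementarySet {i j : Fin d} (h : i ≠ j) :
    transvection h (-1 : ℤ) ∈ elementarySet d := Or.inr ⟨i, j, h, Or.inr rfl⟩

theorem transvection_one_zpow {i j : Fin d} (h : i ≠ j) (n : ℤ) :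
    transvection h (1 : ℤ) ^ n = transvection h n := by
  have h1 : ∀ m : ℕ, transvection h (1 : ℤ) ^ m = transvection h (m : ℤ) := by
    intro m
    induction m with
    | zero => simp [transvection_coeff_zero]
    | succ m ih => rw [pow_succ, ih, ← transvection_add]; push_cast; rfl
  obtain ⟨m, rfl | rfl⟩ := n.eq_nat_or_neg
  · rw [zpow_natCast, h1]
  · rw [_root_.zpow_neg, zpow_natCast, h1, transvection_inv]

theorem transvection_mulVec {i j : Fin d} (h : i ≠ j) (n : ℤ) (w : Fin d → ℤ) :
    (transvection h n : Matrix (Fin d) (Fin d) ℤ) *ᵥ w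
      = Function.update w i (w i + n * w j) := by
  rw [transvection_coe, add_mulVec, one_mulVec, single_mulVec]
  ext l
  by_cases hl : l = i
  · subst hl; simp
  · simp [hl]

theorem eq_of_mulVec_eq {g h : SL(d, ℤ)}
    (hgh : ∀ w, (g : Matrix (Fin d) (Fin d) ℤ) *ᵥ w = (h : Matrix (Fin d) (Fin d) ℤ) *ᵥ w) :
    g = h :=
  Subtype.ext (Matrix.mulVec_injective (funext hgh))

/-- In rank at least three, the elementary matrices are exponentially distorted. -/
theorem shortBy_transvection (hd : 3 ≤ d) {i j : Fin d} (h : i ≠ j) (n : ℤ) :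
    ShortBy (elementarySet d) (18 * (1 + Real.log |(n : ℝ)|)) (transvection h n) := by
  obtain ⟨k, hki, hkj⟩ : ∃ k : Fin d, k ≠ i ∧ k ≠ j := by
    have : ({i, j} : Finset (Fin d)).card < Fintype.card (Fin d) :=
      (Finset.card_le_two).trans_lt (by rw [Fintype.card_fin]; omega)
    obtain ⟨k, hk⟩ := Finset.exists_mem_notMem_of_card_lt_card (s := {i, j}) (t := Finset.univ) this
    simp only [Finset.mem_univ, Finset.mem_insert, Finset.mem_singleton, true_and, not_or] at hk
    exact ⟨k, hk⟩
  -- The third index `k` supplies the second basis vector of `ℤ²`; the conjugating element acts on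
  -- the coordinates `i, k` as `!![2, 1; 1, 1]`.
  have hxy : Commute (transvection h (1 : ℤ)) (transvection hkj 1) := by
    refine eq_of_mulVec_eq fun w => ?_
    ext l
    simp only [coe_mul, ← mulVec_mulVec, transvection_mulVec, Function.update_apply]
    grind
  have hx : (transvection hki.symm (1 : ℤ) * transvection hki 1) * transvection h 1 *
      (transvection hki.symm (1 : ℤ) * transvection hki 1)⁻¹
      = transvection h 1 ^ 2 * transvection hkj 1 := by
    rw [mul_inv_eq_iff_eq_mul, pow_two]
    refine eq_of_mulVec_eq fun w => ?_
    ext l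
    simp only [coe_mul, ← mulVec_mulVec, transvection_mulVec, Function.update_apply]
    grind
  have hy : (transvection hki.symm (1 : ℤ) * transvection hki 1) * transvection hkj 1 *
      (transvection hki.symm (1 : ℤ) * transvection hki 1)⁻¹
      = transvection h 1 * transvection hkj 1 := by
    rw [mul_inv_eq_iff_eq_mul]
    refine eq_of_mulVec_eq fun w => ?_
    ext l
    simp only [coe_mul, ← mulVec_mulVec, transvection_mulVec, Function.update_apply]
    grind
  have ha : ShortBy (elementarySet d) (1 + 1) (transvection hki.symm (1 : ℤ) * transvection hki 1) :=
    (ShortBy.of_mem (transvection_one_mem_elementarySet _)).mul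
      (ShortBy.of_mem (transvection_one_mem_elementarySet _))
  rcases eq_or_ne n 0 with rfl | hn
  · rw [transvection_coeff_zero]
    exact ShortBy.one (by simp)
  have hlt : |n| < 2 ^ (Nat.log 2 n.natAbs + 1) := by
    rw [Int.abs_eq_natAbs]
    exact_mod_cast Nat.lt_pow_succ_log_self one_lt_two n.natAbs
  have hle : (2 : ℝ) ^ Nat.log 2 n.natAbs ≤ |(n : ℝ)| := by
    have := Nat.pow_log_le_self 2 (Int.natAbs_ne_zero.mpr hn)
    rw [← Int.cast_abs, Int.abs_eq_natAbs]
    exact_mod_cast this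
  have hlog : Nat.log 2 n.natAbs * Real.log 2 ≤ Real.log |(n : ℝ)| := by
    rw [← Real.log_pow]
    exact Real.log_le_log (by positivity) hle
  have hs := shortBy_zpow_of_lt_two_pow elementarySet_inv (transvection_one_mem_elementarySet h) ha
    hxy hx hy _ n hlt
  rw [transvection_one_zpow] at hs
  -- With `α = 2` and exponent `m + 1`, where `m = Nat.log 2 |n|`, the length is at most `13 + 12
  -- m`, and `12 / log 2 < 18`.
  refine hs.mono ?_
  have := Real.log_two_gt_d9
  push_cast
  nlinarith [(Nat.cast_nonneg (Nat.log 2 n.natAbs) : (0 : ℝ) ≤ _)]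

/-! ### The Euclidean algorithm at logarithmic cost. -/

theorem exists_balanced_quotient (a b : ℤ) (hb : b ≠ 0) : ∃ q : ℤ, 2 * |a - q * b| ≤ |b| := by
  have h0 := Int.emod_nonneg a hb
  have h1 := Int.emod_lt_abs a hb
  have h2 := Int.emod_add_mul_ediv a b
  by_cases h : 2 * (a % b) ≤ |b|
  · refine ⟨a / b, ?_⟩
    rw [show a - a / b * b = a % b by linarith, abs_of_nonneg h0]
    exact h
  · refine ⟨a / b + b.sign, ?_⟩
    rw [show a - (a / b + b.sign) * b = a % b - |b| by
      rw [add_mul, Int.sign_mul_self_eq_abs]; linarith, abs_of_nonpos (by linarith)]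
    linarith

/-- `ActsOnPlane i j h` says that `h` changes only the coordinates `i` and `j` of a vector, and
fixes the vectors for which both of them vanish. -/
def ActsOnPlane (i j : Fin d) (h : SL(d, ℤ)) : Prop :=
  ∀ w : Fin d → ℤ, (∀ l, l ≠ i → l ≠ j → ((h : Matrix (Fin d) (Fin d) ℤ) *ᵥ w) l = w l) ∧
    (w i = 0 → w j = 0 → (h : Matrix (Fin d) (Fin d) ℤ) *ᵥ w = w)

theorem ActsOnPlane.one (i j : Fin d) : ActsOnPlane i j (1 : SL(d, ℤ)) := by
  intro w
  simp

theorem ActsOnPlane.mul {i j : Fin d} {g h : SL(d, ℤ)} (hg : ActsOnPlane i j g)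
    (hh : ActsOnPlane i j h) : ActsOnPlane i j (g * h) := by
  intro w
  rw [coe_mul, ← mulVec_mulVec]
  refine ⟨fun l hi hj => ?_, fun hi hj => ?_⟩
  · rw [(hg _).1 l hi hj, (hh _).1 l hi hj]
  · rw [(hh w).2 hi hj, (hg w).2 hi hj]

theorem ActsOnPlane.transvection {i j : Fin d} (h : i ≠ j) (n : ℤ) :
    ActsOnPlane i j (transvection h n) := by
  intro w
  rw [transvection_mulVec]
  refine ⟨fun l hi _ => by simp [hi], fun hi hj => by simp [hi, hj]⟩

theorem ActsOnPlane.symm {i j : Fin d} {g : SL(d, ℤ)} (hg : ActsOnPlane i j g) :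
    ActsOnPlane j i g :=
  fun w => ⟨fun l hj hi => (hg w).1 l hi hj, fun hj hi => (hg w).2 hi hj⟩

theorem exists_shortBy_rotation {i j : Fin d} (hij : i ≠ j) :
    ∃ s : SL(d, ℤ), ShortBy (elementarySet d) 3 s ∧ ActsOnPlane i j s ∧
      ∀ w : Fin d → ℤ, ((s : Matrix (Fin d) (Fin d) ℤ) *ᵥ w) i = w j ∧
        ((s : Matrix (Fin d) (Fin d) ℤ) *ᵥ w) j = -w i := by
  refine ⟨transvection hij 1 * transvection hij.symm (-1) * transvection hij 1, ?_, ?_, ?_⟩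
  · exact (((ShortBy.of_mem (transvection_one_mem_elementarySet _)).mul
      (ShortBy.of_mem (transvection_neg_one_mem_elementarySet _))).mul
        (ShortBy.of_mem (transvection_one_mem_elementarySet _))).mono (by norm_num)
  · exact ((ActsOnPlane.transvection hij 1).mul (ActsOnPlane.transvection hij.symm (-1)).symm).mul
      (ActsOnPlane.transvection hij 1)
  · intro w
    simp only [coe_mul, ← mulVec_mulVec, transvection_mulVec, Function.update_apply]
    constructor <;> grind

/-- The Euclidean algorithm with balanced remainders. Since elementary matrices are exponentially
distorted, its cost is the sum of the logarithms of the quotients. -/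
theorem exists_shortBy_euclid_of_abs_le (hd : 3 ≤ d) {i j : Fin d} (hij : i ≠ j) (w : Fin d → ℤ)
    (hw : |w j| ≤ |w i|) :
    ∃ h : SL(d, ℤ), ShortBy (elementarySet d) (100 * (1 + Real.log |(w i : ℝ)| +
        if w j = 0 then 0 else 1 + Real.log |(w j : ℝ)|)) h ∧ ActsOnPlane i j h ∧
      ((h : Matrix (Fin d) (Fin d) ℤ) *ᵥ w) j = 0 ∧
      0 ≤ ((h : Matrix (Fin d) (Fin d) ℤ) *ᵥ w) i := by
  obtain ⟨s, hs, hsP, hsw⟩ := exists_shortBy_rotation hij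
  have hlog : ∀ n : ℤ, 0 ≤ Real.log |(n : ℝ)| := fun n => by
    rw [← Int.cast_abs]
    rcases eq_or_ne n 0 with rfl | hn
    · simp
    · exact Real.log_nonneg (by exact_mod_cast Int.one_le_abs hn)
  induction hn : (w j).natAbs using Nat.strong_induction_on generalizing w with
  | _ n ih =>
    by_cases hb : w j = 0
    · rw [if_pos hb]
      rcases le_total 0 (w i) with h0 | h0
      · exact ⟨1, ShortBy.one (by linarith [hlog (w i)]), ActsOnPlane.one i j, by simpa using hb,
          by simpa using h0⟩
      -- The square of the rotation is `-1` on the plane and corrects the sign.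
      · refine ⟨s * s, (hs.mul hs).mono (by linarith [hlog (w i)]), hsP.mul hsP, ?_, ?_⟩ <;>
        · rw [coe_mul, ← mulVec_mulVec]
          simp only [hsw]
          omega
    · rw [if_neg hb]
      obtain ⟨q, hq⟩ := exists_balanced_quotient (w i) (w j) hb
      set w' : Fin d → ℤ := (s : Matrix (Fin d) (Fin d) ℤ) *ᵥ
        ((transvection hij (-q) : Matrix (Fin d) (Fin d) ℤ) *ᵥ w) with hw'
      have hi : w' i = w j := by
        rw [hw', (hsw _).1, transvection_mulVec]
        simp [hij.symm]
      have hj : w' j = -(w i - q * w j) := by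
        rw [hw', (hsw _).2, transvection_mulVec]
        simp
        ring
      have hbpos : 0 < |w j| := abs_pos.mpr hb
      have hrj : 2 * |w' j| ≤ |w j| := by rwa [hj, abs_neg]
      obtain ⟨h, hh, hhP, hh1, hh2⟩ := ih (w' j).natAbs (by rw [← hn]; zify; omega) w'
        (by rw [hi]; omega) rfl
      refine ⟨h * (s * transvection hij (-q)), (hh.mul (hs.mul
        (shortBy_transvection hd hij (-q)))).mono ?_,
        hhP.mul (hsP.mul (ActsOnPlane.transvection hij (-q))), ?_, ?_⟩
      · rw [hi]
        have hqb : |q| * |w j| ≤ |w i| + |w' j| := by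
          rw [← abs_mul, hj, abs_neg]
          calc |q * w j| = |w i - (w i - q * w j)| := by ring_nf
            _ ≤ _ := abs_sub _ _
        have hnegq : |((-q : ℤ) : ℝ)| = |(q : ℝ)| := by push_cast; exact abs_neg _
        rw [hnegq]
        have hwi := hlog (w i)
        have hwj := hlog (w j)
        have hq0 : q ≠ 0 := by
          rintro rfl
          rw [zero_mul, sub_zero] at hj
          rw [hj, abs_neg] at hrj
          omega
        have hqpos : 0 < |(q : ℝ)| := by positivity
        have hlq := hlog q
        split_ifs with hr
        -- Zero remainder: the extra `1` that the bound carries while `w j ≠ 0` pays for this last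
        -- division.
        · have h1 : |q| ≤ |w i| := by
            rw [hr, abs_zero, add_zero] at hqb
            nlinarith [abs_nonneg q]
          have h2 : Real.log |(q : ℝ)| ≤ Real.log |(w i : ℝ)| :=
            Real.log_le_log hqpos (by exact_mod_cast h1)
          linarith
        · have hrpos : 0 < |(w' j : ℝ)| := by positivity
          -- With `a = w i`, `b = w j` and remainder `r`: `|q||r| ≤ |q||b|/2 ≤ (|a| + |r|)/2 ≤
          -- 3|a|/4`. So `log |a| - log |r|` is at least `log |q| + 1/4`, and `100` times this
          -- covers the step cost `3 + 18 (1 + log |q|)`.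
          have h1 : 4 * (|q| * |w' j|) ≤ 3 * |w i| := by
            nlinarith [abs_nonneg q]
          have h2 : Real.log (4 * (|(q : ℝ)| * |(w' j : ℝ)|)) ≤ Real.log (3 * |(w i : ℝ)|) :=
            Real.log_le_log (by positivity) (by exact_mod_cast h1)
          have hwipos : 0 < |(w i : ℝ)| := by
            have : 0 < |w i| := hbpos.trans_le hw
            exact_mod_cast this
          rw [Real.log_mul (by norm_num) (by positivity), Real.log_mul (by positivity)
            (by positivity), Real.log_mul (by norm_num) (by positivity)] at h2
          have h3 : (1 / 4 : ℝ) ≤ Real.log 4 - Real.log 3 := by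
            rw [← Real.log_div (by norm_num) (by norm_num)]
            have := Real.one_sub_inv_le_log_of_pos (show (0 : ℝ) < 4 / 3 by norm_num)
            norm_num at this ⊢
            linarith
          linarith
      · rw [coe_mul, coe_mul, ← mulVec_mulVec, ← mulVec_mulVec]
        exact hh1
      · rw [coe_mul, coe_mul, ← mulVec_mulVec, ← mulVec_mulVec]
        exact hh2

theorem exists_shortBy_euclid (hd : 3 ≤ d) {i j : Fin d} (hij : i ≠ j) (w : Fin d → ℤ) {B : ℝ}
    (hB : 1 ≤ B) (hi : |(w i : ℝ)| ≤ B) (hj : |(w j : ℝ)| ≤ B) :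
    ∃ h : SL(d, ℤ), ShortBy (elementarySet d) (203 * (1 + Real.log B)) h ∧ ActsOnPlane i j h ∧
      ((h : Matrix (Fin d) (Fin d) ℤ) *ᵥ w) j = 0 ∧
      0 ≤ ((h : Matrix (Fin d) (Fin d) ℤ) *ᵥ w) i := by
  obtain ⟨s, hs, hsP, hsw⟩ := exists_shortBy_rotation hij
  have hlogB : 0 ≤ Real.log B := Real.log_nonneg hB
  have hlog : ∀ n : ℤ, |(n : ℝ)| ≤ B → Real.log |(n : ℝ)| ≤ Real.log B := fun n hn => by
    rcases eq_or_ne n 0 with rfl | hn0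
    · simpa using hlogB
    · exact Real.log_le_log (by positivity) hn
  have key : ∀ w : Fin d → ℤ, |(w i : ℝ)| ≤ B → |(w j : ℝ)| ≤ B → |w j| ≤ |w i| →
      ∃ h : SL(d, ℤ), ShortBy (elementarySet d) (200 * (1 + Real.log B)) h ∧ ActsOnPlane i j h ∧
      ((h : Matrix (Fin d) (Fin d) ℤ) *ᵥ w) j = 0 ∧
      0 ≤ ((h : Matrix (Fin d) (Fin d) ℤ) *ᵥ w) i := by
    intro w hi hj hw
    obtain ⟨h, hh, h1⟩ := exists_shortBy_euclid_of_abs_le hd hij w hw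
    refine ⟨h, hh.mono ?_, h1⟩
    have h2 := hlog _ hi
    have h3 := hlog _ hj
    split_ifs <;> linarith
  rcases le_total |w j| |w i| with hw | hw
  · obtain ⟨h, hh, h1⟩ := key w hi hj hw
    exact ⟨h, hh.mono (by linarith), h1⟩
  · obtain ⟨h, hh, hhP, h1⟩ := key ((s : Matrix (Fin d) (Fin d) ℤ) *ᵥ w) (by rwa [(hsw w).1])
      (by rw [(hsw w).2]; push_cast; rwa [abs_neg]) (by rwa [(hsw w).1, (hsw w).2, abs_neg])
    refine ⟨h * s, (hh.mul hs).mono (by linarith), hhP.mul hsP, ?_⟩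
    rw [coe_mul, ← mulVec_mulVec]
    exact h1

/-! ### Operator norm estimates. -/

theorem abs_apply_le_slNorm (g : SL(d, ℤ)) (i j : Fin d) : |(g i j : ℝ)| ≤ slNorm g := by
  set T := Matrix.toEuclideanCLM (n := Fin d) (𝕜 := ℝ)
    ((g : Matrix (Fin d) (Fin d) ℤ).map Int.cast) with hT
  have h1 : T (WithLp.toLp 2 (Pi.single j 1)) i = (g i j : ℝ) := by
    rw [hT, toEuclideanCLM_toLp]
    simp
  calc |(g i j : ℝ)| = ‖T (WithLp.toLp 2 (Pi.single j 1)) i‖ := by rw [h1, Real.norm_eq_abs]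
    _ ≤ ‖T (WithLp.toLp 2 (Pi.single j 1))‖ := PiLp.norm_apply_le _ i
    _ ≤ ‖T‖ * ‖(WithLp.toLp 2 (Pi.single j 1) : EuclideanSpace ℝ (Fin d))‖ := T.le_opNorm _
    _ = slNorm g := by simp [slNorm, T]

theorem slNorm_mul_le (g h : SL(d, ℤ)) : slNorm (g * h) ≤ slNorm g * slNorm h := by
  have : ((g * h : SL(d, ℤ)) : Matrix (Fin d) (Fin d) ℤ).map (Int.cast : ℤ → ℝ)
      = (g : Matrix (Fin d) (Fin d) ℤ).map Int.cast * (h : Matrix (Fin d) (Fin d) ℤ).map Int.cast := by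
    rw [coe_mul]
    exact Matrix.map_mul (f := Int.castRingHom ℝ)
  rw [slNorm, this, map_mul]
  exact norm_mul_le _ _

theorem one_le_slNorm (hd : 0 < d) (g : SL(d, ℤ)) : 1 ≤ slNorm g := by
  obtain ⟨i, hi⟩ : ∃ i, g i ⟨0, hd⟩ ≠ 0 := by
    by_contra! h
    have := g.det_coe
    rw [Matrix.det_eq_zero_of_column_eq_zero _ h] at this
    exact zero_ne_one this
  refine le_trans ?_ (abs_apply_le_slNorm g i ⟨0, hd⟩)
  exact_mod_cast Int.one_le_abs hi

theorem slNorm_one (hd : 0 < d) : slNorm (1 : SL(d, ℤ)) = 1 := by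
  have : Nonempty (Fin d) := ⟨⟨0, hd⟩⟩
  rw [slNorm, coe_one, Matrix.map_one _ (by simp) (by simp), map_one, norm_one]

theorem log_slNorm_nonneg (hd : 0 < d) (g : SL(d, ℤ)) : 0 ≤ Real.log (slNorm g) :=
  Real.log_nonneg (one_le_slNorm hd g)

theorem log_slNorm_mul_le (hd : 0 < d) (g h : SL(d, ℤ)) :
    Real.log (slNorm (g * h)) ≤ Real.log (slNorm g) + Real.log (slNorm h) := by
  have h1 := one_le_slNorm hd g
  have h2 := one_le_slNorm hd h
  rw [← Real.log_mul (by positivity) (by positivity)]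
  exact Real.log_le_log (by linarith [one_le_slNorm hd (g * h)]) (slNorm_mul_le g h)

open scoped Pointwise in
theorem exists_log_slNorm_le_of_shortBy (hd : 0 < d) : ∃ M : ℝ, 0 ≤ M ∧
    ∀ (r : ℝ) (g : SL(d, ℤ)), ShortBy (elementarySet d) r g → Real.log (slNorm g) ≤ M * r := by
  obtain ⟨M, hM⟩ := (elementarySet_finite.image fun g : SL(d, ℤ) => Real.log (slNorm g)).bddAbove
  have hM0 : 0 ≤ M := by
    simpa [slNorm_one hd] using hM ⟨1, Or.inl rfl, rfl⟩
  refine ⟨M, hM0, ?_⟩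
  rintro r g ⟨n, hn, hg⟩
  suffices h : Real.log (slNorm g) ≤ M * n from h.trans (by gcongr)
  clear hn
  induction n generalizing g with
  | zero =>
    rw [pow_zero, Set.mem_one] at hg
    simp [hg, slNorm_one hd]
  | succ n ih =>
    rw [pow_succ] at hg
    obtain ⟨u, hu, v, hv, rfl⟩ := hg
    have h1 := log_slNorm_mul_le hd u v
    have h2 := ih u hu
    have h3 := hM ⟨v, hv, rfl⟩
    dsimp only at h1 h3 ⊢
    push_cast
    linarith

/-! ### Column-by-column reduction to the identity. -/

/-- `Reduces P Q` says that every matrix with the property `P` is carried to a matrix with the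
property `Q` by left multiplication with a word of logarithmic length. -/
def Reduces (P Q : SL(d, ℤ) → Prop) : Prop :=
  ∃ C : ℝ, 0 ≤ C ∧ ∀ g, P g → ∃ h : SL(d, ℤ),
    ShortBy (elementarySet d) (C * (1 + Real.log (slNorm g))) h ∧ Q (h * g)

namespace Reduces

variable {P Q R : SL(d, ℤ) → Prop}

theorem of_imp (h : ∀ g, P g → Q g) : Reduces P Q :=
  ⟨0, le_rfl, fun g hg => ⟨1, ShortBy.one (by simp), by rw [one_mul]; exact h g hg⟩⟩

theorem trans (hd : 0 < d) (h₁ : Reduces P Q) (h₂ : Reduces Q R) : Reduces P R := by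
  obtain ⟨C, hC, h₁⟩ := h₁
  obtain ⟨D, hD, h₂⟩ := h₂
  obtain ⟨M, hM, hnorm⟩ := exists_log_slNorm_le_of_shortBy hd
  refine ⟨C + D * (1 + M * C), by positivity, fun g hg => ?_⟩
  obtain ⟨h, hh, hQ⟩ := h₁ g hg
  obtain ⟨h', hh', hR⟩ := h₂ _ hQ
  refine ⟨h' * h, (hh'.mul hh).mono ?_, by rwa [mul_assoc]⟩
  have hg0 := log_slNorm_nonneg hd g
  have e1 := log_slNorm_mul_le hd h g
  have e2 := hnorm _ _ hh
  have e3 : D * (1 + Real.log (slNorm (h * g)))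
      ≤ D * ((1 + M * C) * (1 + Real.log (slNorm g))) := by
    gcongr
    linarith
  linarith

end Reduces

/-- The columns of `g` with index less than `k` are those of the identity matrix. -/
def StdCols (k : ℕ) (g : SL(d, ℤ)) : Prop :=
  ∀ c : Fin d, c.val < k → ∀ r, g r c = (1 : Matrix (Fin d) (Fin d) ℤ) r c

theorem mul_apply_eq_mulVec (h g : SL(d, ℤ)) (r c : Fin d) :
    (h * g) r c = ((h : Matrix (Fin d) (Fin d) ℤ) *ᵥ fun l => g l c) r := rfl

/-- The first `k` columns vanish in the coordinates `i, j ≥ k`, so `h` fixes them. -/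
theorem StdCols.mul_left {k : ℕ} {h g : SL(d, ℤ)} (hg : StdCols k g) {i j : Fin d}
    (hh : ActsOnPlane i j h) (hi : k ≤ i.val) (hj : k ≤ j.val) : StdCols k (h * g) := by
  intro c hc r
  have hz : ∀ l : Fin d, k ≤ l.val → g l c = 0 := fun l hl => by
    rw [hg c hc, one_apply_ne]
    rintro rfl
    omega
  rw [mul_apply_eq_mulVec, (hh _).2 (hz i hi) (hz j hj), hg c hc]

theorem reduces_clear_below (hd : 3 ≤ d) (k : Fin d) (s : Finset (Fin d))
    (hs : ∀ j ∈ s, k < j) :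
    Reduces (StdCols k.val)
      (fun g => StdCols k.val g ∧ (∀ j ∈ s, g j k = 0) ∧ (s.Nonempty → 0 ≤ g k k)) := by
  induction s using Finset.induction_on with
  | empty => exact Reduces.of_imp fun g hg => ⟨hg, by simp, by simp⟩
  | insert j s hj ih =>
    refine (ih fun l hl => hs l (Finset.mem_insert_of_mem hl)).trans (by omega) ⟨203, by norm_num, ?_⟩
    rintro g ⟨hg, hgs, -⟩
    have hkj : k < j := hs j (Finset.mem_insert_self _ _)
    obtain ⟨h, hh, hP, h0, hpos⟩ := exists_shortBy_euclid hd hkj.ne (fun l => g l k)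
      (one_le_slNorm (by omega) g) (abs_apply_le_slNorm g k k) (abs_apply_le_slNorm g j k)
    refine ⟨h, hh, hg.mul_left hP le_rfl hkj.le, fun l hl => ?_, fun _ => hpos⟩
    rcases Finset.mem_insert.mp hl with rfl | hl'
    · exact h0
    · rw [mul_apply_eq_mulVec, (hP _).1 l (hs l hl).ne' (ne_of_mem_of_not_mem hl' hj)]
      exact hgs l hl'

/-- Below the last column, the `(k, k)` entry of `g⁻¹ * g = 1` shows that the pivot is a nonnegative
unit. In the last column no Euclidean step has fixed the sign, but `g` is upper triangular and the
determinant gives the pivot. -/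
theorem StdCols.pivot_eq_one {k : Fin d} {g : SL(d, ℤ)} (hg : StdCols k.val g)
    (h0 : ∀ j, k < j → g j k = 0) (hpos : (∃ j, k < j) → 0 ≤ g k k) : g k k = 1 := by
  by_cases hk : ∃ j, k < j
  · have hcol : ∀ c < k, g⁻¹ k c = 0 := by
      intro c hc
      have h1 : (g⁻¹ * g) k c = 0 := by
        rw [inv_mul_cancel, coe_one, one_apply_ne hc.ne']
      rw [coe_mul, Matrix.mul_apply] at h1
      simpa [hg c hc, Matrix.one_apply] using h1
    have h1 : (g⁻¹ * g) k k = 1 := by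
      rw [inv_mul_cancel, coe_one, one_apply_eq]
    rw [coe_mul, Matrix.mul_apply, Finset.sum_eq_single k] at h1
    · exact Int.eq_one_of_mul_eq_one_left (hpos hk) h1
    · intro l _ hl
      rcases lt_or_gt_of_ne hl with hl | hl
      · rw [hcol l hl, zero_mul]
      · rw [h0 l hl, mul_zero]
    · simp
  · push Not at hk
    have htri : (g : Matrix (Fin d) (Fin d) ℤ).IsUpperTriangular := by
      intro r c hrc
      have hck : c < k := lt_of_lt_of_le hrc (hk r)
      exact (hg c hck r).trans (one_apply_ne (ne_of_gt hrc))
    have hdet := g.det_coe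
    rw [Matrix.det_of_isUpperTriangular htri, Finset.prod_eq_single k] at hdet
    · exact hdet
    · intro c _ hc
      rw [hg c (Fin.lt_def.mp (lt_of_le_of_ne (hk c) hc)), one_apply_eq]
    · simp

theorem reduces_clear_column (hd : 3 ≤ d) (k : Fin d) (s : Finset (Fin d)) (hs : k ∉ s) :
    Reduces (fun g => StdCols k.val g ∧ g k k = 1 ∧ ∀ j, k < j → g j k = 0)
      (fun g => StdCols k.val g ∧ g k k = 1 ∧ (∀ j, k < j → g j k = 0) ∧ ∀ j ∈ s, g j k = 0) := by
  induction s using Finset.induction_on with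
  | empty => exact Reduces.of_imp fun g hg => ⟨hg.1, hg.2.1, hg.2.2, by simp⟩
  | insert j s hj ih =>
    refine (ih fun h => hs (Finset.mem_insert_of_mem h)).trans (by omega) ⟨18, by norm_num, ?_⟩
    rintro g ⟨hg, hgk, hgb, hgs⟩
    have hjk : j ≠ k := fun h => hs (h ▸ Finset.mem_insert_self _ _)
    have hrow : ∀ r c, (transvection hjk (-(g j k)) * g) r c
        = if r = j then g j c - g j k * g k c else g r c := by
      intro r c
      rw [mul_apply_eq_mulVec, transvection_mulVec, Function.update_apply]
      split_ifs <;> ring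
    refine ⟨transvection hjk (-(g j k)), (shortBy_transvection hd hjk _).mono ?_, ?_, ?_, ?_, ?_⟩
    · push_cast
      rw [abs_neg]
      have := log_slNorm_nonneg (by omega) g
      rcases eq_or_ne (g j k) 0 with h | h
      · rw [h]; simpa using this
      · have := Real.log_le_log (by positivity) (abs_apply_le_slNorm g j k)
        linarith
    -- Row `k` vanishes in the columns before `k`, so subtracting its multiples keeps them standard.
    · intro c hc r
      rw [hrow, hg c hc, hg c hc, hg c hc, one_apply_ne (fun h : k = c => by simp [h] at hc)]
      split_ifs with h
      · rw [h, mul_zero, sub_zero]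
      · rfl
    · rw [hrow, if_neg hjk.symm, hgk]
    · intro l hl
      rw [hrow, hgb l hl, hgk]
      split_ifs <;> simp
    · intro l hl
      rw [hrow, hgk]
      split_ifs with h
      · simp
      · exact hgs l (Finset.mem_of_mem_insert_of_ne hl h)

theorem reduces_stdCols_succ (hd : 3 ≤ d) (k : Fin d) :
    Reduces (d := d) (StdCols k.val) (StdCols (k.val + 1)) := by
  have hd0 : 0 < d := by omega
  refine (reduces_clear_below hd k (Finset.Ioi k) (by simp)).trans hd0
    ((Reduces.of_imp ?_).trans hd0 ((reduces_clear_column hd k (Finset.univ.erase k)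
      (by simp)).trans hd0 (Reduces.of_imp ?_)))
  · rintro g ⟨hg, h0, hpos⟩
    have h0' : ∀ j, k < j → g j k = 0 := fun j hj => h0 j (by simpa using hj)
    exact ⟨hg, hg.pivot_eq_one h0' fun ⟨j, hj⟩ => hpos ⟨j, by simpa using hj⟩, h0'⟩
  · rintro g ⟨hg, hgk, -, h0⟩ c hc r
    rcases Nat.lt_succ_iff_lt_or_eq.mp hc with hc | hc
    · exact hg c hc r
    · obtain rfl := Fin.ext hc
      rcases eq_or_ne r c with rfl | hr
      · rw [hgk, one_apply_eq]
      · rw [h0 r (by simpa using hr), one_apply_ne hr]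

/-- Every matrix in `SL(d, ℤ)` is a word of logarithmic length in the elementary matrices. -/
theorem exists_shortBy_log_slNorm (hd : 3 ≤ d) : ∃ C : ℝ, 0 ≤ C ∧
    ∀ g : SL(d, ℤ), ShortBy (elementarySet d) (C * (1 + Real.log (slNorm g))) g := by
  have key : ∀ k ≤ d, Reduces (d := d) (fun _ => True) (StdCols k) := by
    intro k
    induction k with
    | zero => exact fun _ => Reduces.of_imp fun g _ c hc => absurd hc (Nat.not_lt_zero _)
    | succ k ih =>
      exact fun hk => (ih (by omega)).trans (by omega) (reduces_stdCols_succ hd ⟨k, hk⟩)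
  obtain ⟨C, hC, h⟩ := key d le_rfl
  refine ⟨C, hC, fun g => ?_⟩
  obtain ⟨h, hh, hstd⟩ := h g trivial
  obtain rfl : h = g⁻¹ := eq_inv_of_mul_eq_one_left
    (Subtype.ext (Matrix.ext fun r c => hstd c c.isLt r))
  simpa using hh.inv elementarySet_inv

/-! ### Word distance for an arbitrary generating set. -/

section WordDist

variable {G : Type*} [Group G] {S : Set G}

theorem wordDist_one_le {w : List G} (hw : ∀ x ∈ w, x ∈ S ∨ x⁻¹ ∈ S) :
    wordDist S 1 w.prod ≤ w.length :=
  Nat.sInf_le ⟨w, rfl, hw, by simp⟩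

open scoped Pointwise in
theorem exists_word_length_eq_wordDist (hS : Subgroup.closure S = ⊤) (g : G) :
    ∃ w : List G, w.length = wordDist S 1 g ∧ (∀ x ∈ w, x ∈ S ∨ x⁻¹ ∈ S) ∧ w.prod = g := by
  have hne : {n : ℕ | ∃ w : List G, w.length = n ∧ (∀ x ∈ w, x ∈ S ∨ x⁻¹ ∈ S) ∧
      w.prod = 1⁻¹ * g}.Nonempty := by
    have hg : g ∈ Submonoid.closure (S ∪ S⁻¹) := by
      rw [← Subgroup.closure_toSubmonoid, hS]
      trivial
    obtain ⟨w, hw, hwg⟩ := Submonoid.exists_list_of_mem_closure hg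
    exact ⟨_, w, rfl, hw, by simpa using hwg⟩
  obtain ⟨w, h1, h2, h3⟩ := Nat.sInf_mem hne
  exact ⟨w, h1, h2, by simpa using h3⟩

theorem wordDist_one_one : wordDist S 1 1 = 0 :=
  Nat.le_zero.mp (wordDist_one_le (S := S) (w := []) (by simp))

theorem wordDist_one_mul_le (hS : Subgroup.closure S = ⊤) (g h : G) :
    wordDist S 1 (g * h) ≤ wordDist S 1 g + wordDist S 1 h := by
  obtain ⟨v, hv, hvS, rfl⟩ := exists_word_length_eq_wordDist hS g
  obtain ⟨w, hw, hwS, rfl⟩ := exists_word_length_eq_wordDist hS h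
  rw [← hv, ← hw, ← List.prod_append, ← List.length_append]
  refine wordDist_one_le fun x hx => ?_
  rcases List.mem_append.mp hx with hx | hx
  · exact hvS x hx
  · exact hwS x hx

open scoped Pointwise in
theorem exists_wordDist_map_le_of_shortBy {H : Type*} [Group H] (hS : Subgroup.closure S = ⊤)
    {E : Set H} (hE : E.Finite) (φ : H →* G) : ∃ B : ℝ, 0 ≤ B ∧
      ∀ (r : ℝ) (h : H), ShortBy E r h → (wordDist S 1 (φ h) : ℝ) ≤ B * r := by
  obtain ⟨B, hB⟩ := (hE.image fun h => wordDist S 1 (φ h)).bddAbove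
  refine ⟨B, B.cast_nonneg, ?_⟩
  rintro r h ⟨n, hn, hh⟩
  suffices key : wordDist S 1 (φ h) ≤ B * n by
    calc (wordDist S 1 (φ h) : ℝ) ≤ B * n := by exact_mod_cast key
      _ ≤ B * r := by gcongr
  clear hn
  induction n generalizing h with
  | zero =>
    rw [pow_zero, Set.mem_one] at hh
    simp [hh, wordDist_one_one]
  | succ n ih =>
    rw [pow_succ] at hh
    obtain ⟨u, hu, v, hv, rfl⟩ := hh
    have h1 := wordDist_one_mul_le hS (φ u) (φ v)
    have h2 := ih u hu
    have h3 := hB ⟨v, hv, rfl⟩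
    dsimp only at h3 ⊢
    rw [map_mul]
    linarith

end WordDist

theorem finite_setOf_slNorm_le (N : ℕ) : {g : SL(d, ℤ) | slNorm g ≤ N}.Finite := by
  have hfin : (Set.univ.pi fun _ : Fin d => Set.univ.pi fun _ : Fin d =>
      Set.Icc (-(N : ℤ)) N).Finite :=
    Set.Finite.pi fun _ => Set.Finite.pi fun _ => Set.finite_Icc _ _
  refine (hfin.preimage (f := fun g : SL(d, ℤ) => (g : Matrix (Fin d) (Fin d) ℤ))
    Subtype.val_injective.injOn).subset fun g hg i _ j _ => ?_
  have h := (abs_apply_le_slNorm g i j).trans hg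
  exact Set.mem_Icc.mpr (abs_le.mp (by exact_mod_cast h))

theorem group_fg_SL (hd : 3 ≤ d) : Group.FG SL(d, ℤ) := by
  obtain ⟨C, -, hC⟩ := exists_shortBy_log_slNorm hd
  exact Group.fg_iff.mpr ⟨elementarySet d, (Subgroup.eq_top_iff' _).mpr fun g => (hC g).mem_closure,
    elementarySet_finite⟩

end SpecialLinear

theorem theorem4p2 (d : ℕ) (hd : 3 ≤ d) :
    Group.FG PSL(d, ℤ) ∧
      ∀ S : Set PSL(d, ℤ), S.Finite → Subgroup.closure S = ⊤ →
        ∃ K : ℝ, 0 < K ∧ ∀ γ : PSL(d, ℤ), (γ = 1 ∨ pslNorm γ ≠ 1) →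
          (wordDist S 1 γ : ℝ) ≤ K * Real.log (pslNorm γ) := by
  have hfg := group_fg_SL hd
  refine ⟨Group.fg_of_surjective (QuotientGroup.mk'_surjective (Subgroup.center SL(d, ℤ))), ?_⟩
  intro S _ hS
  obtain ⟨C, hC0, hC⟩ := exists_shortBy_log_slNorm hd
  obtain ⟨B, hB0, hB⟩ := exists_wordDist_map_le_of_shortBy hS (elementarySet_finite (d := d))
    (QuotientGroup.mk' (Subgroup.center SL(d, ℤ)))
  -- For norms in `(1, 2]` the additive constant is absorbed by a maximum over finitely many ratios;
  -- matrices of norm `1` contribute the harmless value `x / 0 = 0`.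
  obtain ⟨A, hA⟩ := ((finite_setOf_slNorm_le (d := d) 2).image fun g =>
    (wordDist S 1 (QuotientGroup.mk g : PSL(d, ℤ)) : ℝ) / Real.log (slNorm g)).bddAbove
  refine ⟨|A| + 3 * (B * C) + 1, by positivity, fun γ hγ => ?_⟩
  induction γ using QuotientGroup.induction_on with
  | H g =>
  rw [pslNorm_mk] at hγ ⊢
  have hlog := log_slNorm_nonneg (by omega) g
  rcases hγ with h1 | h1
  · rw [h1, wordDist_one_one, Nat.cast_zero]
    positivity
  have hgt : 1 < slNorm g := lt_of_le_of_ne (one_le_slNorm (by omega) g) h1.symm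
  have hpos := Real.log_pos hgt
  rcases le_total (slNorm g) 2 with h2 | h2
  · have h3 := hA ⟨g, by simpa using h2, rfl⟩
    dsimp only at h3
    rw [div_le_iff₀ hpos] at h3
    refine h3.trans (mul_le_mul_of_nonneg_right ?_ hlog)
    have := le_abs_self A
    have : 0 ≤ B * C := by positivity
    linarith
  · have h3 := hB _ _ (hC g)
    have h4 : Real.log 2 ≤ Real.log (slNorm g) := Real.log_le_log (by norm_num) h2
    have h5 := Real.log_two_gt_d9
    -- Here `1 ≤ 2 * log ‖g‖`, because `log ‖g‖ ≥ log 2 > 1/2`.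
    have h6 : B * (C * (1 + Real.log (slNorm g))) ≤ B * (C * (3 * Real.log (slNorm g))) := by
      gcongr
      linarith
    have h7 : 0 ≤ |A| * Real.log (slNorm g) := by positivity
    refine (h3.trans h6).trans ?_
    linarith
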